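/- Let $G$ and $H$ be free groups of finite rank with fixed free bases $a_1,\dots,a_n$ of $G$ ($n=\operatorname{rank} G\ge 0$) and $b_1,\dots,b_m$ of $H$ ($m=\operatorname{rank} H$). For $p\in\mathbb N$ let $H_p$ be the finite set of elements of $H$ of reduced word length at most $p$. For $S\subseteq H$ let $$\overline D(S)=\limsup_{p\to\infty}\frac{|S\cap H_p|}{|H_p|}$$ be the upper asymptotic density; when the limit exists it equals the asymptotic density $D(S)=\lim_{p\to\infty}|S\cap H_p|/|H_p|$. A homomorphism $\phi:G\to H$ is identified with the tuple $(\phi(a_1),\dots,\phi(a_n))\in H^n$, and the expected density of the image subgroup $\phi(G)$ is $$\mathrm{ED}(G,H)=\lim_{p\to\infty}\frac1{|H_p|^n}\sum_{\phi\in (H_p)^n}\overline D(\phi(G)).$$ 1. If $\operatorname{rank} H=1$ and $\operatorname{rank} G=n>1$, then the limit defining $\mathrm{ED}(G,H)$ exists and $\mathrm{ED}(G,H)=\zeta(n+1)/\zeta(n)$, where $\zeta$ is the Riemann zeta function. 2. If $G$ and $H$ both have rank $1$, or if $\operatorname{rank} H>1$, then the limit defining $\mathrm{ED}(G,H)$ exists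 and $\mathrm{ED}(G,H)=0$. Moreover, if $\operatorname{rank} H=1$, then the density $D(\phi(G))$ exists for every homomorphism $\phi:G\to H$, so that $\overline D$ may be replaced by $D$ in the definition of $\mathrm{ED}(G,H)$. -/

import Mathlib

open Filter Topology

noncomputable section

namespace FreeDensity

variable {ι κ G H : Type*} [Group G] [Group H]

/-- The reduced word length of `h` with respect to the free basis `b`. -/
def wordLength [DecidableEq κ] (b : FreeGroupBasis κ H) (h : H) : ℕ :=
  (b.repr h).norm

theorem finite_wordLength_le [DecidableEq κ] [Finite κ] (b : FreeGroupBasis κ H) (p : ℕ) :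
    {h : H | wordLength b h ≤ p}.Finite := by
  refine Set.Finite.of_finite_image
    (f := fun h => (b.repr h).toWord) ((List.finite_length_le (κ × Bool) p).subset ?_)
    (FreeGroup.toWord_injective.comp b.repr.injective).injOn
  rintro _ ⟨h, hh, rfl⟩
  exact hh

/-- The ball `H_p`: all elements of reduced word length at most `p`. -/
def wordBall [DecidableEq κ] [Finite κ] (b : FreeGroupBasis κ H) (p : ℕ) : Finset H :=
  (finite_wordLength_le b p).toFinset

/-- The proportion `|S ∩ H_p| / |H_p|`. -/
def ballRatio [DecidableEq κ] [Finite κ] (b : FreeGroupBasis κ H) (S : Set H) (p : ℕ) : ℝ :=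
  ((S ∩ (wordBall b p : Set H)).ncard : ℝ) / ((wordBall b p).card : ℝ)

/-- The asymptotic density `D(S) = lim_p |S ∩ H_p| / |H_p|` exists and equals `d`. -/
def HasDensity [DecidableEq κ] [Finite κ] (b : FreeGroupBasis κ H) (S : Set H) (d : ℝ) : Prop :=
  Tendsto (ballRatio b S) atTop (𝓝 d)

/-- The upper asymptotic density `limsup_p |S ∩ H_p| / |H_p|`. It is always defined (the ratios lie
in `[0, 1]`), and it is the density `D(S)` whenever the latter exists. -/
def upperDensity [DecidableEq κ] [Finite κ] (b : FreeGroupBasis κ H) (S : Set H) : ℝ :=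
  limsup (ballRatio b S) atTop

/-- The average of the density of `φ(G)` over all homomorphisms `φ : G → H` that send every basis
element of `G` into `H_p`; such a `φ` is given by the tuple of images of the basis of `G`. -/
def averageDensity [Fintype ι] [DecidableEq ι] [DecidableEq κ] [Finite κ]
    (bG : FreeGroupBasis ι G) (bH : FreeGroupBasis κ H) (p : ℕ) : ℝ :=
  1 / ((wordBall bH p).card : ℝ) ^ Fintype.card ι *
    ∑ t ∈ Fintype.piFinset (fun _ : ι => wordBall bH p),
      upperDensity bH ((bG.lift t).range : Set H)

/-- The expected density `ED(G, H)` of the image of a homomorphism `G → H` exists and equals `e`. -/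
def HasExpectedDensity [Fintype ι] [DecidableEq ι] [DecidableEq κ] [Finite κ]
    (bG : FreeGroupBasis ι G) (bH : FreeGroupBasis κ H) (e : ℝ) : Prop :=
  Tendsto (averageDensity bG bH) atTop (𝓝 e)

end FreeDensity

end

noncomputable section

namespace FreeDensity

open scoped ArithmeticFunction.Moebius

/-! If `H` has rank one it is `ℤ`, the ball is `[-p, p]`, and the image of a homomorphism is `dℤ`
with `d` the gcd of the tuple (`mem_range_lift_iff`); its density is `1 / d`, read as `0` for `d =
0`. The average is thus that of `1 / gcd` over a cube. Sorting points by gcd turns the sum into `∑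
(1 / d) * primitiveCount (p / d)`, and Möbius inversion writes `primitiveCount` as a sum of the same
shape. `tendsto_sum_dilate` (dominated convergence) handles both: primitive points have density `∑
μ(d) / d ^ n = 1 / ζ(n)`, and the outer sum multiplies this by `ζ(n + 1)`. For `n = 1` there are at
most two primitive points, so the limit is `0`.

If `H` has rank above one, balls at least double with each unit of radius. Hence in most tuples all
entries are long and the entries and their inverses have pairwise distinct prefixes of length `L`.
Ping-pong (`lt_norm_of_mem_closure`) then shows that nontrivial elements of the image are longer
than `2 * C`, and truncating elements of such a subgroup packs about `C + 1` times as many distinct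
elements into the ball (`card_subgroup_inter_wordBall_le`). So the density is at most `2 / (C + 1)`
off a negligible set of tuples. -/

/-! ### Integer points of a cube by greatest common divisor -/

/-- The integer points of the cube `[-q, q]^ι`. -/
def intBox (ι : Type*) [Fintype ι] [DecidableEq ι] (q : ℕ) : Finset (ι → ℤ) :=
  Fintype.piFinset fun _ => Finset.Icc (-(q : ℤ)) q

/-- The greatest common divisor of a finite family of integers. -/
def tupleGcd {ι : Type*} [Fintype ι] (z : ι → ℤ) : ℕ :=
  Finset.univ.gcd fun i => (z i).natAbs

/-- The number of primitive integer points of the cube `[-q, q]^ι`. -/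
def primitiveCount (ι : Type*) [Fintype ι] [DecidableEq ι] (q : ℕ) : ℕ :=
  ((intBox ι q).filter fun z => tupleGcd z = 1).card

theorem filter_dvd_Icc (q d : ℕ) (hd : 0 < d) :
    (Finset.Icc (-(q : ℤ)) q).filter (fun k => (d : ℤ) ∣ k) =
      (Finset.Icc (-((q / d : ℕ) : ℤ)) ((q / d : ℕ) : ℤ)).image (fun k => (d : ℤ) * k) := by
  have hd' : (0 : ℤ) < d := by exact_mod_cast hd
  ext k
  simp only [Finset.mem_filter, Finset.mem_Icc, Finset.mem_image]
  constructor
  · rintro ⟨⟨h1, h2⟩, c, rfl⟩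
    refine ⟨c, ⟨?_, ?_⟩, rfl⟩
    · push_cast
      rw [neg_le, Int.le_ediv_iff_mul_le hd']
      linarith
    · push_cast
      rw [Int.le_ediv_iff_mul_le hd']
      linarith
  · rintro ⟨c, ⟨h1, h2⟩, rfl⟩
    push_cast at h1 h2
    rw [neg_le, Int.le_ediv_iff_mul_le hd'] at h1
    rw [Int.le_ediv_iff_mul_le hd'] at h2
    exact ⟨⟨by linarith, by linarith⟩, dvd_mul_right _ _⟩

theorem card_filter_dvd_Icc (q d : ℕ) (hd : 0 < d) :
    ((Finset.Icc (-(q : ℤ)) q).filter (fun k => (d : ℤ) ∣ k)).card = 2 * (q / d) + 1 := by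
  have hd' : (d : ℤ) ≠ 0 := by exact_mod_cast hd.ne'
  rw [filter_dvd_Icc q d hd, Finset.card_image_of_injective _ (mul_right_injective₀ hd'),
    Int.card_Icc]
  omega

section
variable {ι : Type*} [Fintype ι]

theorem dvd_tupleGcd_iff {d : ℕ} {z : ι → ℤ} : d ∣ tupleGcd z ↔ ∀ i, (d : ℤ) ∣ z i := by
  simp [tupleGcd, Finset.dvd_gcd_iff, Int.natCast_dvd]

theorem tupleGcd_eq_zero_iff {z : ι → ℤ} : tupleGcd z = 0 ↔ z = 0 := by
  simp [tupleGcd, Finset.gcd_eq_zero_iff, funext_iff]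

theorem tupleGcd_mul (d : ℕ) (z : ι → ℤ) :
    tupleGcd (fun i => (d : ℤ) * z i) = d * tupleGcd z := by
  simp [tupleGcd, Int.natAbs_mul, Finset.gcd_mul_left]

variable [DecidableEq ι]

theorem mem_intBox {q : ℕ} {z : ι → ℤ} : z ∈ intBox ι q ↔ ∀ i, -(q : ℤ) ≤ z i ∧ z i ≤ q := by
  simp [intBox]

theorem zero_mem_intBox (q : ℕ) : (0 : ι → ℤ) ∈ intBox ι q := by
  simp [mem_intBox]

theorem card_filter_dvd_tupleGcd (q d : ℕ) (hd : 0 < d) :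
    ((intBox ι q).filter fun z => d ∣ tupleGcd z).card = (2 * (q / d) + 1) ^ Fintype.card ι := by
  have : (intBox ι q).filter (fun z => d ∣ tupleGcd z) =
      Fintype.piFinset fun _ : ι => (Finset.Icc (-(q : ℤ)) q).filter (fun k => (d : ℤ) ∣ k) := by
    ext z
    simp only [intBox, Finset.mem_filter, Fintype.mem_piFinset, dvd_tupleGcd_iff, forall_and]
  rw [this, Fintype.card_piFinset]
  simp only [card_filter_dvd_Icc q d hd, Finset.prod_const, Finset.card_univ]

theorem card_intBox (q : ℕ) : (intBox ι q).card = (2 * q + 1) ^ Fintype.card ι := by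
  have h := card_filter_dvd_tupleGcd (ι := ι) q 1 one_pos
  simpa using h

/-- Multiplication by `d` is a bijection from the primitive points of the smaller cube. -/
theorem card_filter_tupleGcd_eq (q d : ℕ) (hd : 0 < d) :
    ((intBox ι q).filter fun z => tupleGcd z = d).card = primitiveCount ι (q / d) := by
  have hd' : (0 : ℤ) < d := by exact_mod_cast hd
  symm
  refine Finset.card_bij (fun z _ i => (d : ℤ) * z i) ?_ ?_ ?_
  · intro z hz
    simp only [Finset.mem_filter, mem_intBox] at hz ⊢
    refine ⟨fun i => ?_, by rw [tupleGcd_mul, hz.2, mul_one]⟩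
    obtain ⟨h1, h2⟩ := hz.1 i
    push_cast at h1 h2
    rw [neg_le, Int.le_ediv_iff_mul_le hd'] at h1
    rw [Int.le_ediv_iff_mul_le hd'] at h2
    constructor <;> linarith
  · intro z _ w _ h
    funext i
    exact mul_left_cancel₀ hd'.ne' (congrFun h i)
  · intro z hz
    simp only [Finset.mem_filter, mem_intBox] at hz
    choose w hw using dvd_tupleGcd_iff.1 (dvd_of_eq hz.2.symm)
    have hz' : z = fun i => (d : ℤ) * w i := funext hw
    refine ⟨w, ?_, hz'.symm⟩
    simp only [Finset.mem_filter, mem_intBox]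
    constructor
    · intro i
      obtain ⟨h1, h2⟩ := hz.1 i
      rw [hw i] at h1 h2
      push_cast
      rw [neg_le, Int.le_ediv_iff_mul_le hd', Int.le_ediv_iff_mul_le hd']
      constructor <;> linarith
    · have := hz.2
      rw [hz', tupleGcd_mul] at this
      exact Nat.eq_of_mul_eq_mul_left hd (by rw [this, mul_one])

theorem tupleGcd_le {q : ℕ} {z : ι → ℤ} (hz : z ∈ intBox ι q) : tupleGcd z ≤ q := by
  by_cases h : z = 0
  · simp [tupleGcd_eq_zero_iff.2 h]
  · obtain ⟨i, hi⟩ := Function.ne_iff.1 h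
    have h1 : tupleGcd z ∣ (z i).natAbs := Finset.gcd_dvd (Finset.mem_univ i)
    have h2 := Nat.le_of_dvd (Int.natAbs_pos.2 hi) h1
    have := mem_intBox.1 hz i
    omega

/-- Möbius inversion for the number of primitive points. -/
theorem primitiveCount_eq_sum (q N : ℕ) (hN : q < N) :
    (primitiveCount ι q : ℝ) =
      ∑ d ∈ Finset.range N, (μ d : ℝ) * ((2 * (q / d : ℕ) + 1 : ℝ) ^ Fintype.card ι - 1) := by
  -- The origin is left out because every `d` divides its gcd `0`; this is the source of the `- 1`.
  -- Elsewhere all divisors of the gcd are below `N`, and their Möbius values sum to `[gcd = 1]`.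
  have h1 : (primitiveCount ι q : ℝ) = ∑ z ∈ (intBox ι q).erase 0,
      ∑ d ∈ Finset.range N, if d ∣ tupleGcd z then (μ d : ℝ) else 0 := by
    rw [primitiveCount, Finset.card_filter, Nat.cast_sum,
      ← Finset.sum_erase_add _ _ (zero_mem_intBox q)]
    have h0 : tupleGcd (0 : ι → ℤ) = 0 := tupleGcd_eq_zero_iff.2 rfl
    simp only [h0, zero_ne_one, if_false, Nat.cast_zero, add_zero]
    refine Finset.sum_congr rfl fun z hz => ?_
    obtain ⟨hz0, hz⟩ := Finset.mem_erase.1 hz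
    have hg : tupleGcd z ≠ 0 := mt tupleGcd_eq_zero_iff.1 hz0
    have hle := tupleGcd_le hz
    have hs : (Finset.range N).filter (fun d => d ∣ tupleGcd z) = (tupleGcd z).divisors := by
      ext d
      simp only [Finset.mem_filter, Finset.mem_range, Nat.mem_divisors]
      refine ⟨fun h => ⟨h.2, hg⟩, fun h => ⟨?_, h.1⟩⟩
      exact lt_of_le_of_lt ((Nat.le_of_dvd (Nat.pos_of_ne_zero hg) h.1).trans hle) hN
    rw [← Finset.sum_filter, hs]
    have h := congrArg (fun f => f (tupleGcd z)) ArithmeticFunction.moebius_mul_coe_zeta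
    simp only [ArithmeticFunction.coe_mul_zeta_apply, ArithmeticFunction.one_apply] at h
    rw [← Int.cast_sum, h]
    split_ifs <;> simp
  rw [h1, Finset.sum_comm]
  refine Finset.sum_congr rfl fun d _ => ?_
  rcases Nat.eq_zero_or_pos d with rfl | hd
  · simp
  · rw [← Finset.sum_filter, Finset.sum_const, nsmul_eq_mul, mul_comm, Finset.filter_erase,
      Finset.card_erase_of_mem (by simp [zero_mem_intBox, tupleGcd_eq_zero_iff.2 rfl]),
      card_filter_dvd_tupleGcd q d hd, Nat.cast_sub (Nat.one_le_pow _ _ (by omega))]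
    push_cast
    rfl

theorem sum_inv_tupleGcd (q N : ℕ) (hN : q < N) :
    ∑ z ∈ intBox ι q, (1 : ℝ) / tupleGcd z =
      ∑ d ∈ Finset.range N, (1 / d : ℝ) * primitiveCount ι (q / d) := by
  rw [← Finset.sum_fiberwise_of_maps_to (g := tupleGcd) (t := Finset.range N)
    (fun z hz => Finset.mem_range.2 ((tupleGcd_le hz).trans_lt hN))]
  refine Finset.sum_congr rfl fun d _ => ?_
  rw [Finset.sum_congr rfl (g := fun _ => (1 / d : ℝ))
    (fun z hz => by rw [(Finset.mem_filter.1 hz).2])]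
  -- The fibre of gcd `0` is the origin, with weight `1 / 0 = 0`.
  rcases Nat.eq_zero_or_pos d with rfl | hd
  · simp
  · rw [Finset.sum_const, nsmul_eq_mul, card_filter_tupleGcd_eq q d hd, mul_comm]

theorem primitiveCount_zero : primitiveCount ι 0 = 0 := by
  rw [primitiveCount, Finset.card_eq_zero, Finset.filter_eq_empty_iff]
  intro z hz h
  have := tupleGcd_le hz
  omega

theorem primitiveCount_le (q : ℕ) : primitiveCount ι q ≤ (2 * q + 1) ^ Fintype.card ι := by
  rw [← card_intBox]
  exact Finset.card_filter_le _ _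

theorem primitiveCount_le_two (h : Fintype.card ι = 1) (q : ℕ) : primitiveCount ι q ≤ 2 := by
  obtain ⟨i, hi⟩ := Fintype.card_eq_one_iff.1 h
  have : Finset.univ = ({i} : Finset ι) := by ext; simp [hi]
  calc primitiveCount ι q ≤ ({1, -1} : Finset (ι → ℤ)).card := by
        refine Finset.card_le_card fun z hz => ?_
        have h1 := (Finset.mem_filter.1 hz).2
        simp only [tupleGcd, this, Finset.gcd_singleton, normalize_eq] at h1
        simp only [Finset.mem_insert, Finset.mem_singleton, funext_iff]
        rcases Int.natAbs_eq_iff.1 h1 with h | h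
        · left; intro x; rw [hi x, h]; rfl
        · right; intro x; rw [hi x, h]; rfl
    _ ≤ 2 := Finset.card_le_two

end

/-! ### Asymptotics of dilated sums and zeta values -/

/-- The proportion of multiples of `d` in `[-p, p]` tends to `1 / d`. -/
theorem tendsto_dilate_ratio (d : ℕ) :
    Tendsto (fun p : ℕ => (2 * ((p / d : ℕ) : ℝ) + 1) / (2 * p + 1)) atTop (𝓝 (1 / d)) := by
  have h0 : Tendsto (fun p : ℕ => (2 * (p : ℝ) + 1)) atTop atTop :=
    tendsto_atTop_add_const_right _ _
      (tendsto_natCast_atTop_atTop.const_mul_atTop (by norm_num))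
  -- For `d = 0` the conventions `p / 0 = 0` and `1 / 0 = 0` give the correct density of the trivial
  -- subgroup.
  rcases Nat.eq_zero_or_pos d with rfl | hd
  · simpa [Pi.inv_def] using h0.inv_tendsto_atTop
  have hd' : (0 : ℝ) < d := by exact_mod_cast hd
  rw [tendsto_iff_norm_sub_tendsto_zero]
  refine squeeze_zero (fun _ => norm_nonneg _) (fun p => ?_)
    (h0.const_div_atTop (((d : ℝ) + 1) / d))
  have h1 : (d : ℝ) * ((p / d : ℕ) : ℝ) ≤ p := by exact_mod_cast Nat.mul_div_le p d
  have h2 : (p : ℝ) < d * ((p / d : ℕ) : ℝ) + d := by exact_mod_cast Nat.lt_mul_div_succ p hd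
  have h3 : (0 : ℝ) < 2 * p + 1 := by positivity
  rw [Real.norm_eq_abs, div_sub_div _ _ h3.ne' hd'.ne', abs_div, abs_of_pos (mul_pos h3 hd'),
    div_div, mul_comm (d : ℝ) (2 * p + 1)]
  gcongr
  rw [abs_le]
  constructor <;> linarith

/-- Summation of a dilated function of polynomial growth. -/
theorem tendsto_sum_dilate {n : ℕ} (hn : n ≠ 0) {B : ℕ → ℝ} {β : ℝ} (c : ℕ → ℝ)
    (hB : ∀ q, |B q| ≤ (3 * q) ^ n)
    (hβ : Tendsto (fun q : ℕ => B q / (2 * q + 1) ^ n) atTop (𝓝 β))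
    (hc : Summable fun d : ℕ => |c d| / (d : ℝ) ^ n) :
    Tendsto (fun p : ℕ => (∑ d ∈ Finset.range (p + 1), c d * B (p / d)) / (2 * p + 1) ^ n) atTop
      (𝓝 (β * ∑' d, c d / (d : ℝ) ^ n)) := by
  -- Terms with `d > p` therefore vanish, and the finite sum is a full series.
  have hB0 : B 0 = 0 := by simpa [hn] using hB 0
  have key : Tendsto (fun p : ℕ => ∑' d, c d * B (p / d) / (2 * p + 1) ^ n) atTop
      (𝓝 (∑' d, β * (c d / (d : ℝ) ^ n))) := by
    -- The factor `(3 / 2) ^ n` compares `(3 * p / d) ^ n` with `(2 * p) ^ n / d ^ n`.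
    refine tendsto_tsum_of_dominated_convergence
      (bound := fun d => (3 / 2) ^ n * (|c d| / (d : ℝ) ^ n)) (hc.mul_left _) ?_ ?_
    · intro d
      rcases Nat.eq_zero_or_pos d with rfl | hd
      · simp [hB0, hn]
      have hd' : (0 : ℝ) < d := by exact_mod_cast hd
      have h1 : Tendsto (fun p : ℕ => p / d) atTop atTop :=
        Nat.tendsto_div_const_atTop hd.ne'
      have h2 := hβ.comp h1
      have h3 : Tendsto (fun p : ℕ => (2 * ((p / d : ℕ) : ℝ) + 1) / (2 * p + 1)) atTop
          (𝓝 (1 / d)) := tendsto_dilate_ratio d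
      have h4 := (h2.mul (h3.pow n)).const_mul (c d)
      convert h4 using 2 with p
      · simp only [Function.comp, div_pow]
        have : (2 * ((p / d : ℕ) : ℝ) + 1) ^ n ≠ 0 := by positivity
        field_simp
      · rw [div_pow, one_pow]; ring
    · refine Eventually.of_forall fun p d => ?_
      rcases Nat.eq_zero_or_pos d with rfl | hd
      · simp [hB0, hn]
      have hd' : (0 : ℝ) < d := by exact_mod_cast hd
      have h1 : |B (p / d)| ≤ (3 * (p / d)) ^ n :=
        (hB _).trans (by gcongr; exact Nat.cast_div_le)
      have h2 : (2 * p : ℝ) ^ n ≤ (2 * p + 1) ^ n := by gcongr; linarith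
      rw [norm_div, norm_mul, Real.norm_eq_abs, Real.norm_eq_abs, Real.norm_eq_abs,
        abs_of_pos (by positivity : (0 : ℝ) < (2 * p + 1) ^ n), div_le_iff₀ (by positivity)]
      calc |c d| * |B (p / d)| ≤ |c d| * (3 * (p / d)) ^ n := by gcongr
        _ = (3 / 2) ^ n * (|c d| / d ^ n) * (2 * p) ^ n := by
          simp only [mul_pow, div_pow]; field_simp
        _ ≤ _ := by gcongr
  rw [tsum_mul_left] at key
  refine key.congr fun p => ?_
  rw [Finset.sum_div]
  refine tsum_eq_sum fun d hd => ?_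
  rw [Finset.mem_range, not_lt] at hd
  rw [Nat.div_eq_of_lt (by omega), hB0]
  simp

theorem tendsto_pow_ratio (n : ℕ) :
    Tendsto (fun q : ℕ => ((2 * (q : ℝ) + 1) ^ n - 1) / (2 * q + 1) ^ n) atTop
      (𝓝 (1 - if n = 0 then 1 else 0)) := by
  have h0 : Tendsto (fun p : ℕ => (2 * (p : ℝ) + 1)) atTop atTop :=
    tendsto_atTop_add_const_right _ _
      (tendsto_natCast_atTop_atTop.const_mul_atTop (by norm_num))
  have h1 : Tendsto (fun p : ℕ => 1 - (((2 * (p : ℝ) + 1))⁻¹) ^ n) atTop (𝓝 (1 - 0 ^ n)) :=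
    tendsto_const_nhds.sub (h0.inv_tendsto_atTop.pow n)
  rw [zero_pow_eq] at h1
  refine h1.congr fun q => ?_
  have : (2 * (q : ℝ) + 1) ^ n ≠ 0 := by positivity
  rw [sub_div, div_self this, inv_pow, one_div]

theorem abs_pow_sub_one_le {n : ℕ} (hn : n ≠ 0) (q : ℕ) :
    |(2 * (q : ℝ) + 1) ^ n - 1| ≤ (3 * q) ^ n := by
  have h1 : (1 : ℝ) ≤ (2 * (q : ℝ) + 1) ^ n := one_le_pow₀ (by linarith [q.cast_nonneg (α := ℝ)])
  rw [abs_of_nonneg (by linarith)]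
  rcases Nat.eq_zero_or_pos q with rfl | hq
  · simp [hn]
  · have : (1 : ℝ) ≤ q := by exact_mod_cast hq
    have : (2 * (q : ℝ) + 1) ^ n ≤ (3 * q) ^ n := by gcongr; linarith
    linarith

theorem primitiveCount_le_three_mul {ι : Type*} [Fintype ι] [DecidableEq ι]
    (hn : Fintype.card ι ≠ 0) (q : ℕ) :
    |(primitiveCount ι q : ℝ)| ≤ (3 * q) ^ Fintype.card ι := by
  rw [abs_of_nonneg (Nat.cast_nonneg _)]
  rcases Nat.eq_zero_or_pos q with rfl | hq
  · simp [primitiveCount_zero, hn]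
  · have h1 : (1 : ℝ) ≤ q := by exact_mod_cast hq
    calc (primitiveCount ι q : ℝ) ≤ (2 * q + 1) ^ Fintype.card ι := by
          exact_mod_cast primitiveCount_le q
      _ ≤ _ := by gcongr; linarith

theorem summable_abs_moebius {n : ℕ} (hn : 1 < n) :
    Summable fun d : ℕ => |(μ d : ℝ)| / (d : ℝ) ^ n := by
  refine Summable.of_nonneg_of_le (fun _ => by positivity) (fun d => ?_)
    (Real.summable_one_div_nat_pow.2 hn)
  gcongr
  exact_mod_cast ArithmeticFunction.abs_moebius_le_one

theorem tendsto_primitiveCount {ι : Type*} [Fintype ι] [DecidableEq ι] (hn : 1 < Fintype.card ι) :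
    Tendsto (fun q : ℕ => (primitiveCount ι q : ℝ) / (2 * q + 1) ^ Fintype.card ι) atTop
      (𝓝 (∑' d : ℕ, (μ d : ℝ) / (d : ℝ) ^ Fintype.card ι)) := by
  have hn0 : Fintype.card ι ≠ 0 := by omega
  have h := tendsto_sum_dilate hn0 (fun d => (μ d : ℝ)) (abs_pow_sub_one_le hn0)
    (tendsto_pow_ratio (Fintype.card ι)) (summable_abs_moebius hn)
  rw [if_neg hn0, sub_zero, one_mul] at h
  refine h.congr fun q => ?_
  rw [primitiveCount_eq_sum q (q + 1) (by omega)]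

theorem tendsto_primitiveCount_of_card_eq_one {ι : Type*} [Fintype ι] [DecidableEq ι]
    (hn : Fintype.card ι = 1) :
    Tendsto (fun q : ℕ => (primitiveCount ι q : ℝ) / (2 * q + 1) ^ Fintype.card ι) atTop
      (𝓝 0) := by
  have h0 : Tendsto (fun p : ℕ => (2 * (p : ℝ) + 1)) atTop atTop :=
    tendsto_atTop_add_const_right _ _
      (tendsto_natCast_atTop_atTop.const_mul_atTop (by norm_num))
  refine squeeze_zero (fun _ => by positivity) (fun q => ?_) (h0.const_div_atTop 2)
  rw [hn, pow_one]
  gcongr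
  exact_mod_cast primitiveCount_le_two hn q

/-- The average of `1 / gcd` over the cube `[-p, p]^ι`. -/
theorem tendsto_average_inv_gcd {ι : Type*} [Fintype ι] [DecidableEq ι]
    (hn : Fintype.card ι ≠ 0) {β : ℝ}
    (hβ : Tendsto (fun q : ℕ => (primitiveCount ι q : ℝ) / (2 * q + 1) ^ Fintype.card ι) atTop
      (𝓝 β)) :
    Tendsto (fun p : ℕ => (∑ z ∈ intBox ι p, (1 : ℝ) / tupleGcd z) / (2 * p + 1) ^ Fintype.card ι)
      atTop (𝓝 (β * ∑' d : ℕ, 1 / (d : ℝ) ^ (Fintype.card ι + 1))) := by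
  have e : ∀ d : ℕ, (1 / d : ℝ) / (d : ℝ) ^ Fintype.card ι = 1 / (d : ℝ) ^ (Fintype.card ι + 1) :=
    fun d => by rw [div_div, pow_succ']
  have h := tendsto_sum_dilate hn (fun d => (1 / d : ℝ)) (primitiveCount_le_three_mul hn) hβ (by
    refine (Real.summable_one_div_nat_pow.2 (by omega : 1 < Fintype.card ι + 1)).congr fun d => ?_
    rw [abs_of_nonneg (by positivity), e])
  simp only [e] at h
  refine h.congr fun p => ?_
  rw [sum_inv_tupleGcd p (p + 1) (by omega)]

theorem tsum_moebius_div_pow {n : ℕ} (hn : 1 < n) :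
    ((∑' d : ℕ, (μ d : ℝ) / (d : ℝ) ^ n : ℝ) : ℂ) = (riemannZeta n)⁻¹ := by
  have hs : 1 < (n : ℂ).re := by simpa using hn
  have h := ArithmeticFunction.LSeries_zeta_mul_Lseries_moebius hs
  rw [ArithmeticFunction.LSeries_zeta_eq_riemannZeta hs] at h
  rw [← eq_inv_of_mul_eq_one_right h, LSeries, Complex.ofReal_tsum]
  refine tsum_congr fun d => ?_
  rcases Nat.eq_zero_or_pos d with rfl | hd
  · simp
  · rw [LSeries.term_of_ne_zero hd.ne']
    simp

theorem tsum_one_div_pow {n : ℕ} (hn : 1 < n) :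
    ((∑' d : ℕ, 1 / (d : ℝ) ^ n : ℝ) : ℂ) = riemannZeta n := by
  rw [zeta_nat_eq_tsum_of_gt_one hn, Complex.ofReal_tsum]
  simp

/-! ### Free groups of rank one -/

theorem norm_eq_natAbs {κ : Type*} [DecidableEq κ] [Unique κ] (x : FreeGroup κ) :
    x.norm = (FreeGroup.mulEquivIntOfUnique x).toAdd.natAbs := by
  obtain ⟨k, rfl⟩ : ∃ k : ℤ, FreeGroup.of default ^ k = x := by
    refine ⟨(FreeGroup.mulEquivIntOfUnique x).toAdd, FreeGroup.mulEquivIntOfUnique.injective ?_⟩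
    rw [map_zpow]
    apply Multiplicative.toAdd.injective
    simp [FreeGroup.mulEquivIntOfUnique, FreeGroup.equivIntOfUnique]
  have h : (FreeGroup.mulEquivIntOfUnique (FreeGroup.of (default : κ) ^ k)).toAdd = k := by
    rw [map_zpow]
    simp [FreeGroup.mulEquivIntOfUnique, FreeGroup.equivIntOfUnique]
  rw [h]
  rcases Int.eq_nat_or_neg k with ⟨n, rfl | rfl⟩ <;> simp [FreeGroup.norm_of_pow]

theorem range_lift_eq_closure {ι G H : Type*} [Group G] [Group H] (bG : FreeGroupBasis ι G)
    (t : ι → H) : (bG.lift t).range = Subgroup.closure (Set.range t) := by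
  rw [← FreeGroup.range_lift_eq_closure]
  ext h
  simp only [MonoidHom.mem_range, FreeGroupBasis.lift_apply_apply]
  exact ⟨fun ⟨g, hg⟩ => ⟨bG.repr g, hg⟩, fun ⟨w, hw⟩ => ⟨bG.repr.symm w, by simpa using hw⟩⟩

section
variable {κ H : Type*} [Group H]

/-- The identification with `ℤ` of a free group on one generator. -/
def toInt [Unique κ] (b : FreeGroupBasis κ H) : H ≃* Multiplicative ℤ :=
  b.repr.trans FreeGroup.mulEquivIntOfUnique

variable [Unique κ] (b : FreeGroupBasis κ H)

theorem toInt_toAdd_injective : Function.Injective fun h : H => (toInt b h).toAdd :=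
  Multiplicative.toAdd.injective.comp (toInt b).injective

/-- Subgroups of `ℤ` are cyclic; `d = 0` is the trivial one. -/
theorem exists_mem_iff_dvd (S : Subgroup H) :
    ∃ d : ℕ, ∀ h, h ∈ S ↔ (d : ℤ) ∣ (toInt b h).toAdd := by
  let K : AddSubgroup ℤ := Subgroup.toAddSubgroup' (S.map (toInt b).toMonoidHom)
  obtain ⟨a, ha⟩ := Int.subgroup_cyclic K
  refine ⟨a.natAbs, fun h => ?_⟩
  have h1 : (toInt b h).toAdd ∈ K ↔ h ∈ S := by
    change toInt b h ∈ S.map (toInt b).toMonoidHom ↔ _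
    exact Subgroup.mem_map_iff_mem (f := (toInt b).toMonoidHom) (toInt b).injective
  rw [← h1, ha, ← AddSubgroup.zmultiples_eq_closure, Int.mem_zmultiples_iff, Int.natAbs_dvd]

/-- Bézout without coefficients: the image consists of the multiples of some `d`, and `d` divides
every generator, hence their gcd. -/
theorem mem_range_lift_iff {ι G : Type*} [Group G] [Fintype ι] (bG : FreeGroupBasis ι G)
    (t : ι → H) (h : H) :
    h ∈ (bG.lift t).range ↔
      (tupleGcd (fun i => (toInt b (t i)).toAdd) : ℤ) ∣ (toInt b h).toAdd := by
  obtain ⟨d, hd⟩ := exists_mem_iff_dvd b (bG.lift t).range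
  rw [range_lift_eq_closure] at hd ⊢
  constructor
  · intro hh
    induction hh using Subgroup.closure_induction with
    | mem x hx =>
      obtain ⟨i, rfl⟩ := hx
      exact dvd_tupleGcd_iff.1 dvd_rfl i
    | one => simp
    | mul x y _ _ hx hy =>
      rw [map_mul, toAdd_mul]
      exact dvd_add hx hy
    | inv x _ hx =>
      rw [map_inv, toAdd_inv]
      exact hx.neg_right
  · intro hh
    refine (hd h).2 (dvd_trans ?_ hh)
    rw [Int.natCast_dvd_natCast, dvd_tupleGcd_iff]
    exact fun i => (hd _).1 (Subgroup.subset_closure ⟨i, rfl⟩)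

end

section
variable {κ H : Type*} [Group H] [DecidableEq κ]

theorem mem_wordBall [Finite κ] {b : FreeGroupBasis κ H} {p : ℕ} {h : H} :
    h ∈ wordBall b p ↔ wordLength b h ≤ p := by
  simp [wordBall]

variable [Unique κ] (b : FreeGroupBasis κ H)

theorem wordLength_eq_natAbs (h : H) : wordLength b h = (toInt b h).toAdd.natAbs :=
  norm_eq_natAbs _

theorem image_wordBall (p : ℕ) :
    (wordBall b p).image (fun h => (toInt b h).toAdd) = Finset.Icc (-(p : ℤ)) p := by
  ext k
  simp only [Finset.mem_image, mem_wordBall, wordLength_eq_natAbs, Finset.mem_Icc]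
  constructor
  · rintro ⟨h, hh, rfl⟩
    omega
  · intro hk
    refine ⟨(toInt b).symm (Multiplicative.ofAdd k), ?_, by simp⟩
    simp only [MulEquiv.apply_symm_apply, toAdd_ofAdd]
    omega

theorem card_wordBall_of_unique (p : ℕ) : (wordBall b p).card = 2 * p + 1 := by
  rw [← Finset.card_image_of_injective _ (toInt_toAdd_injective b), image_wordBall, Int.card_Icc]
  omega

theorem ballRatio_of_mem_iff {S : Set H} {d : ℕ} (hS : ∀ h, h ∈ S ↔ (d : ℤ) ∣ (toInt b h).toAdd)
    (p : ℕ) : ballRatio b S p = (2 * ((p / d : ℕ) : ℝ) + 1) / (2 * p + 1) := by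
  classical
  have h1 : (S ∩ (wordBall b p : Set H)).ncard = 2 * (p / d) + 1 := by
    have h2 : (fun h : H => (toInt b h).toAdd) '' (S ∩ (wordBall b p : Set H)) =
        ((Finset.Icc (-(p : ℤ)) p).filter (fun k => (d : ℤ) ∣ k) : Finset ℤ) := by
      rw [← image_wordBall b p]
      ext k
      simp only [Set.mem_image, Set.mem_inter_iff, hS, Finset.mem_coe, Finset.mem_filter,
        Finset.mem_image]
      constructor
      · rintro ⟨h, ⟨h1, h2⟩, rfl⟩
        exact ⟨⟨h, h2, rfl⟩, h1⟩
      · rintro ⟨⟨h, h2, rfl⟩, h1⟩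
        exact ⟨h, ⟨h1, h2⟩, rfl⟩
    rw [← Set.ncard_image_of_injective _ (toInt_toAdd_injective b), h2, Set.ncard_coe_finset]
    rcases Nat.eq_zero_or_pos d with rfl | hd
    · simp only [Nat.cast_zero, zero_dvd_iff, Nat.div_zero]
      rw [Finset.filter_eq', if_pos (by simp)]
      rfl
    · exact card_filter_dvd_Icc p d hd
  rw [ballRatio, h1, card_wordBall_of_unique]
  push_cast
  rfl

theorem hasDensity_of_mem_iff {S : Set H} {d : ℕ}
    (hS : ∀ h, h ∈ S ↔ (d : ℤ) ∣ (toInt b h).toAdd) : HasDensity b S (1 / d) :=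
  (tendsto_dilate_ratio d).congr fun p => (ballRatio_of_mem_iff b hS p).symm

theorem exists_hasDensity_range {G : Type*} [Group G] (φ : G →* H) :
    ∃ d : ℝ, HasDensity b (φ.range : Set H) d := by
  obtain ⟨d, hd⟩ := exists_mem_iff_dvd b φ.range
  exact ⟨_, hasDensity_of_mem_iff b hd⟩

theorem averageDensity_of_unique {ι G : Type*} [Group G] [Fintype ι] [DecidableEq ι]
    (bG : FreeGroupBasis ι G) (p : ℕ) :
    averageDensity bG b p =
      (∑ z ∈ intBox ι p, (1 : ℝ) / tupleGcd z) / (2 * p + 1) ^ Fintype.card ι := by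
  rw [averageDensity, card_wordBall_of_unique, one_div_mul_eq_div]
  push_cast
  congr 1
  refine Finset.sum_bij (fun t _ i => (toInt b (t i)).toAdd) ?_ ?_ ?_ ?_
  · intro t ht
    refine Fintype.mem_piFinset.2 fun i => ?_
    rw [← image_wordBall b]
    exact Finset.mem_image_of_mem _ (Fintype.mem_piFinset.1 ht i)
  · intro s _ t _ hst
    exact funext fun i => toInt_toAdd_injective b (congrFun hst i)
  · intro z hz
    have h1 := fun i => Fintype.mem_piFinset.1 hz i
    simp only [← image_wordBall b, Finset.mem_image] at h1
    choose t ht htz using h1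
    exact ⟨t, Fintype.mem_piFinset.2 ht, funext htz⟩
  · intro t _
    exact (hasDensity_of_mem_iff b (mem_range_lift_iff b bG t)).limsup_eq

end

/-! ### Reduced words -/

/-- Applied to the words of `u⁻¹` and `v`, the common part `c` is exactly what cancels in `u * v`.
-/
theorem exists_eq_append_of_take_ne {α : Type*} {L : ℕ} : ∀ {a b : List α}, L ≤ a.length →
    L ≤ b.length → a.take L ≠ b.take L →
    ∃ c x y a' b', a = c ++ x :: a' ∧ b = c ++ y :: b' ∧ x ≠ y ∧ c.length < L := by
  classical
  induction L with
  | zero => simp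
  | succ L ih =>
    rintro (_ | ⟨x, a⟩) (_ | ⟨y, b⟩) ha hb hab
    · simp at ha
    · simp at ha
    · simp at hb
    by_cases hxy : x = y
    · subst hxy
      obtain ⟨c, x', y', a', b', rfl, rfl, hne, hc⟩ := @ih a b (by simpa using ha)
        (by simpa using hb) (by simpa using hab)
      exact ⟨x :: c, x', y', a', b', rfl, rfl, hne, by simpa using hc⟩
    · exact ⟨[], x, y, a, b, rfl, rfl, hxy, by simp⟩

theorem toWord_mk_of_isReduced {κ : Type*} [DecidableEq κ] {w : List (κ × Bool)}
    (h : FreeGroup.IsReduced w) : (FreeGroup.mk w).toWord = w := by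
  rw [FreeGroup.toWord_mk, h.reduce_eq]

/-- If fewer than `L` letters cancel in the product `u * v`, then all but the last `L` letters of
`u` survive. -/
theorem take_prefix_toWord_mul {κ : Type*} [DecidableEq κ] {u v : FreeGroup κ} {L : ℕ}
    (hu : L ≤ u.norm) (hv : L ≤ v.norm) (h : u⁻¹.toWord.take L ≠ v.toWord.take L) :
    u.toWord.take (u.norm - L) <+: (u * v).toWord := by
  obtain ⟨c, x, y, a', b', ha, hb, hxy, hc⟩ := exists_eq_append_of_take_ne
    (by rw [← FreeGroup.norm, FreeGroup.norm_inv_eq]; exact hu) hv h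
  have hu' : u.toWord =
      FreeGroup.invRev a' ++ [(x.1, !x.2)] ++ FreeGroup.invRev c := by
    rw [← inv_inv u, FreeGroup.toWord_inv, ha]
    simp [FreeGroup.invRev]
  -- After `c` is removed, the letters meeting at the junction are `x⁻¹` and `y`; they do not cancel
  -- because `x ≠ y`.
  have hred : FreeGroup.IsReduced (FreeGroup.invRev a' ++ [(x.1, !x.2)] ++ y :: b') := by
    refine FreeGroup.IsReduced.append_overlap ?_ ?_ (by simp)
    · exact (FreeGroup.isReduced_toWord (x := u)).infix ⟨[], FreeGroup.invRev c, by rw [hu']; simp⟩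
    · rw [List.singleton_append, FreeGroup.isReduced_cons_cons]
      refine ⟨fun h1 => ?_, (FreeGroup.isReduced_toWord (x := v)).infix ⟨c, [], by rw [hb]; simp⟩⟩
      by_contra h2
      refine hxy (Prod.ext h1 ?_)
      revert h2
      cases x.2 <;> cases y.2 <;> simp
  have huv : (u * v).toWord = FreeGroup.invRev a' ++ [(x.1, !x.2)] ++ y :: b' := by
    rw [← toWord_mk_of_isReduced hred]
    congr 1
    rw [← FreeGroup.mk_toWord (x := u), ← FreeGroup.mk_toWord (x := v), hu', hb]
    simp only [← FreeGroup.mul_mk, ← FreeGroup.inv_mk]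
    group
  have hlen : u.norm = (FreeGroup.invRev a' ++ [(x.1, !x.2)]).length + c.length := by
    rw [FreeGroup.norm, hu', List.length_append (bs := FreeGroup.invRev c),
      FreeGroup.invRev_length (L₁ := c)]
  rw [huv, hu']
  refine (List.prefix_append_of_prefix ?_)
  rw [List.take_append_of_le_length (by omega)]
  exact List.take_prefix _ _

/-- A ping-pong argument. -/
theorem lt_norm_of_mem_closure {ι κ : Type*} [DecidableEq ι] [DecidableEq κ]
    {f : ι → FreeGroup κ} {L M : ℕ} (hlen : ∀ i, 2 * L + M < (f i).norm)
    (hinj : ∀ x y : ι × Bool, (bif x.2 then f x.1 else (f x.1)⁻¹).toWord.take L =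
      (bif y.2 then f y.1 else (f y.1)⁻¹).toWord.take L → x = y)
    {g : FreeGroup κ} (hg : g ∈ Subgroup.closure (Set.range f)) (hg1 : g ≠ 1) : M < g.norm := by
  set T : ι × Bool → FreeGroup κ := fun x => bif x.2 then f x.1 else (f x.1)⁻¹ with hT
  have hTn : ∀ x, 2 * L + M < (T x).norm := by
    rintro ⟨i, _ | _⟩ <;> simp [hT, FreeGroup.norm_inv_eq, hlen]
  have hTi : ∀ x : ι × Bool, (T x)⁻¹ = T (x.1, !x.2) := by
    rintro ⟨i, _ | _⟩ <;> simp [hT]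
  -- Invariant: all but the last `L` letters of the first factor survive. Since factors are longer
  -- than `2 * L + M`, the surviving part still shows the prefix of length `L` and has more than `M`
  -- letters.
  have key : ∀ (w : List (ι × Bool)) (x : ι × Bool), FreeGroup.IsReduced (x :: w) →
      (T x).toWord.take ((T x).norm - L) <+: (FreeGroup.lift f (FreeGroup.mk (x :: w))).toWord := by
    intro w
    induction w with
    | nil =>
      intro x _
      simp only [FreeGroup.lift_mk, List.map_cons, List.map_nil, List.prod_cons, List.prod_nil,
        mul_one]
      exact List.take_prefix _ _
    | cons y w ih =>
      intro x hx
      rw [FreeGroup.isReduced_cons_cons] at hx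
      have h1 := ih y hx.2
      have hsplit : FreeGroup.lift f (FreeGroup.mk (x :: y :: w)) =
          T x * FreeGroup.lift f (FreeGroup.mk (y :: w)) := by
        simp [FreeGroup.lift_mk, hT]
      rw [hsplit]
      have hxn := hTn x
      have hyn := hTn y
      have h2 := h1.length_le
      rw [List.length_take, ← FreeGroup.norm, ← FreeGroup.norm] at h2
      refine take_prefix_toWord_mul (by omega) (by omega) ?_
      have h3 : (FreeGroup.lift f (FreeGroup.mk (y :: w))).toWord.take L =
          (T y).toWord.take L := by
        obtain ⟨r, hr⟩ := h1
        rw [← hr, List.take_append_of_le_length, List.take_take, min_eq_left (by omega)]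
        rw [List.length_take, ← FreeGroup.norm]
        omega
      rw [h3, hTi]
      intro h4
      -- Equal prefixes would make `y` the inverse letter of `x`, contradicting reducedness of `x ::
      -- y :: w`.
      have h5 := hinj _ _ h4
      rw [← h5] at hx
      have := hx.1 rfl
      revert this
      cases x.2 <;> simp
  rw [← FreeGroup.range_lift_eq_closure] at hg
  obtain ⟨w, rfl⟩ := hg
  rw [← FreeGroup.mk_toWord (x := w)] at hg1 ⊢
  have hred := FreeGroup.isReduced_toWord (x := w)
  generalize w.toWord = l at hg1 hred
  cases l with
  | nil => exact absurd (by simp [FreeGroup.lift_mk]) hg1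
  | cons x l =>
    have h1 := (key l x hred).length_le
    have := hTn x
    rw [List.length_take, ← FreeGroup.norm, ← FreeGroup.norm] at h1
    omega

section
variable {κ H : Type*} [Group H] [DecidableEq κ] (b : FreeGroupBasis κ H)

/-! ### Balls in a free group -/

/-- The reduced word of an element. -/
def word (h : H) : List (κ × Bool) := (b.repr h).toWord

/-- The element spelled by a word. -/
def ofWord (w : List (κ × Bool)) : H := b.repr.symm (FreeGroup.mk w)

theorem isReduced_word (h : H) : FreeGroup.IsReduced (word b h) := FreeGroup.isReduced_toWord

theorem length_word (h : H) : (word b h).length = wordLength b h := rfl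

theorem ofWord_word (h : H) : ofWord b (word b h) = h := by
  simp [ofWord, word, FreeGroup.mk_toWord]

theorem word_injective : Function.Injective (word b) :=
  Function.LeftInverse.injective (ofWord_word b)

theorem word_ofWord {w : List (κ × Bool)} (hw : FreeGroup.IsReduced w) :
    word b (ofWord b w) = w := by
  simp [ofWord, word, hw.reduce_eq]

theorem word_inv (h : H) : word b h⁻¹ = FreeGroup.invRev (word b h) := by
  simp [word, FreeGroup.toWord_inv]

theorem wordLength_inv (h : H) : wordLength b h⁻¹ = wordLength b h := by
  simp [wordLength, FreeGroup.norm_inv_eq]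

theorem wordLength_mul_le (g h : H) : wordLength b (g * h) ≤ wordLength b g + wordLength b h := by
  simpa [wordLength] using FreeGroup.norm_mul_le _ _

theorem wordLength_one : wordLength b 1 = 0 := by
  simp [wordLength]

/-- The element `u` is spelled by `s` without its last `j` letters. -/
theorem exists_wordLength_truncate (s : H) {j : ℕ} (hj : j ≤ wordLength b s) :
    ∃ u : H, wordLength b u = wordLength b s - j ∧ wordLength b (u⁻¹ * s) ≤ j := by
  refine ⟨ofWord b ((word b s).take (wordLength b s - j)), ?_, ?_⟩
  · rw [← length_word, word_ofWord b ((isReduced_word b s).infix (List.take_prefix _ _).isInfix),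
      List.length_take, length_word]
    omega
  · have h : s = ofWord b ((word b s).take (wordLength b s - j)) *
        ofWord b ((word b s).drop (wordLength b s - j)) := by
      rw [ofWord, ofWord, ← map_mul, FreeGroup.mul_mk, List.take_append_drop]
      exact (ofWord_word b s).symm
    nth_rewrite 3 [h]
    rw [inv_mul_cancel_left, ← length_word,
      word_ofWord b ((isReduced_word b s).infix (List.drop_suffix _ _).isInfix),
      List.length_drop, length_word]
    omega

variable [Finite κ]

theorem one_mem_wordBall (p : ℕ) : (1 : H) ∈ wordBall b p := by
  rw [mem_wordBall, wordLength_one]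
  exact Nat.zero_le _

theorem card_wordBall_pos (p : ℕ) : 0 < (wordBall b p).card :=
  Finset.card_pos.2 ⟨1, one_mem_wordBall b p⟩

theorem ballRatio_nonneg (S : Set H) (p : ℕ) : 0 ≤ ballRatio b S p := by
  unfold ballRatio
  positivity

theorem ballRatio_le_one (S : Set H) (p : ℕ) : ballRatio b S p ≤ 1 := by
  refine div_le_one_of_le₀ ?_ (by positivity)
  rw [← Set.ncard_coe_finset (wordBall b p)]
  exact_mod_cast Set.ncard_le_ncard Set.inter_subset_right (Finset.finite_toSet _)

theorem isBoundedUnder_ballRatio (S : Set H) : IsBoundedUnder (· ≤ ·) atTop (ballRatio b S) :=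
  isBoundedUnder_of ⟨1, ballRatio_le_one b S⟩

theorem isCoboundedUnder_ballRatio (S : Set H) : IsCoboundedUnder (· ≤ ·) atTop (ballRatio b S) :=
  (isBoundedUnder_of ⟨0, ballRatio_nonneg b S⟩ :
    IsBoundedUnder (· ≥ ·) atTop (ballRatio b S)).isCoboundedUnder_le

theorem upperDensity_nonneg (S : Set H) : 0 ≤ upperDensity b S :=
  le_limsup_of_frequently_le (Frequently.of_forall (ballRatio_nonneg b S))
    (isBoundedUnder_ballRatio b S)

theorem upperDensity_le {S : Set H} {c : ℝ} (h : ∀ᶠ p in atTop, ballRatio b S p ≤ c) :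
    upperDensity b S ≤ c :=
  limsup_le_of_le (isCoboundedUnder_ballRatio b S) h

theorem upperDensity_le_one (S : Set H) : upperDensity b S ≤ 1 :=
  upperDensity_le b (Eventually.of_forall (ballRatio_le_one b S))

/-- A subgroup without short elements has few elements in each ball. -/
theorem card_subgroup_inter_wordBall_le (S : Subgroup H) (C p : ℕ)
    (hS : ∀ h ∈ S, h ≠ 1 → 2 * C < wordLength b h) :
    (C + 1) * ((S : Set H) ∩ (wordBall b p : Set H)).ncard ≤
      (C + 1) + (wordBall b p).card := by
  classical
  let A := (wordBall b p).filter (fun h => h ∈ S)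
  have hA : ((S : Set H) ∩ (wordBall b p : Set H)).ncard = A.card := by
    rw [← Set.ncard_coe_finset]
    congr 1
    ext h
    simp [A, and_comm]
  choose! u hu1 hu2 using fun (s : H) (j : ℕ) (hj : j ≤ wordLength b s) =>
    exists_wordLength_truncate b s hj
  -- Send `(s, j)` with `j ≤ C` to `s` shortened by `j` letters. If two pairs agree, `s⁻¹ * s'` has
  -- length at most `2 * C`, so `s = s'`; the length of the image then determines `j`.
  have h1 : (A.erase 1).card * (C + 1) ≤ (wordBall b p).card := by
    rw [← Finset.card_range (C + 1), ← Finset.card_product]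
    have hmem : ∀ x ∈ A.erase 1 ×ˢ Finset.range (C + 1), x.1 ≠ 1 ∧ x.1 ∈ S ∧
        wordLength b x.1 ≤ p ∧ x.2 ≤ C ∧ 2 * C < wordLength b x.1 := by
      intro x hx
      simp only [A, Finset.mem_product, Finset.mem_erase, Finset.mem_filter, mem_wordBall,
        Finset.mem_range] at hx
      exact ⟨hx.1.1, hx.1.2.2, hx.1.2.1, by omega, hS _ hx.1.2.2 hx.1.1⟩
    refine Finset.card_le_card_of_injOn (fun x => u x.1 x.2) ?_ ?_
    · intro x hx
      obtain ⟨h1, h2, h3, h4, h5⟩ := hmem x hx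
      refine mem_wordBall.2 ?_
      rw [hu1 x.1 x.2 (by omega)]
      omega
    · rintro ⟨s, j⟩ hx ⟨s', j'⟩ hx' heq
      obtain ⟨h1, h2, h3, h4, h5⟩ := hmem _ hx
      obtain ⟨h1', h2', h3', h4', h5'⟩ := hmem _ hx'
      simp only at *
      have e1 := hu1 s j (by omega)
      have e2 := hu2 s j (by omega)
      have e1' := hu1 s' j' (by omega)
      have e2' := hu2 s' j' (by omega)
      have hss : s = s' := by
        by_contra hne
        have h6 := hS (s⁻¹ * s') (S.mul_mem (S.inv_mem h2) h2') (by
          rwa [ne_eq, inv_mul_eq_one])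
        have h7 : s⁻¹ * s' = (((u s j)⁻¹ * s)⁻¹) * ((u s' j')⁻¹ * s') := by
          rw [heq]; group
        have h8 := wordLength_mul_le b (((u s j)⁻¹ * s)⁻¹) ((u s' j')⁻¹ * s')
        rw [← h7, wordLength_inv] at h8
        omega
      subst hss
      rw [heq] at e1
      simp only [Prod.mk.injEq, true_and]
      omega
  have h2 : A.card = (A.erase 1).card + 1 :=
    (Finset.card_erase_add_one (Finset.mem_filter.2 ⟨one_mem_wordBall b p, S.one_mem⟩)).symm
  rw [hA, h2]
  linarith

/-- Prepending a generator or its inverse, whichever does not cancel. -/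
theorem card_wordBall_succ (p : ℕ) :
    Nat.card κ * (wordBall b p).card ≤ (wordBall b (p + 1)).card := by
  classical
  have := Fintype.ofFinite κ
  let e : κ → List (κ × Bool) → List (κ × Bool) := fun k w =>
    (k, if w.head? = some (k, false) then false else true) :: w
  have he : ∀ k w, FreeGroup.IsReduced w → FreeGroup.IsReduced (e k w) := by
    rintro k (_ | ⟨⟨k', ε⟩, w⟩) hw
    · simp [e]
    · rw [FreeGroup.isReduced_cons_cons]
      refine ⟨?_, hw⟩
      intro h
      obtain rfl : k = k' := h
      cases ε <;> simp
  rw [Nat.card_eq_fintype_card, ← Finset.card_univ, ← Finset.card_product]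
  refine Finset.card_le_card_of_injOn (fun x => ofWord b (e x.1 (word b x.2))) ?_ ?_
  · rintro ⟨k, h⟩ hx
    have hh := mem_wordBall.1 (Finset.mem_product.1 hx).2
    refine mem_wordBall.2 ?_
    rw [← length_word, word_ofWord b (he _ _ (isReduced_word b h))]
    simpa [e, length_word] using hh
  · rintro ⟨k, h⟩ _ ⟨k', h'⟩ _ heq
    have h1 := congrArg (word b) heq
    simp only [word_ofWord b (he _ _ (isReduced_word b _)), e, List.cons.injEq,
      Prod.mk.injEq] at h1
    -- The head letter reveals `k` whatever its sign, and the tail reveals `h`.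
    exact Prod.ext h1.1.1 (word_injective b h1.2)

theorem two_pow_mul_card_wordBall_le (hκ : 1 < Nat.card κ) (p L : ℕ) :
    2 ^ L * (wordBall b p).card ≤ (wordBall b (p + L)).card := by
  induction L with
  | zero => simp
  | succ L ih =>
    calc 2 ^ (L + 1) * (wordBall b p).card = 2 * (2 ^ L * (wordBall b p).card) := by ring
      _ ≤ Nat.card κ * (wordBall b (p + L)).card := Nat.mul_le_mul hκ ih
      _ ≤ _ := card_wordBall_succ b (p + L)

theorem card_wordBall_sub_le (hκ : 1 < Nat.card κ) {p L : ℕ} (hL : L ≤ p) :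
    ((wordBall b (p - L)).card : ℝ) ≤ (1 / 2) ^ L * (wordBall b p).card := by
  have h := two_pow_mul_card_wordBall_le b hκ (p - L) L
  rw [Nat.sub_add_cancel hL] at h
  have h' : (2 : ℝ) ^ L * (wordBall b (p - L)).card ≤ (wordBall b p).card := by exact_mod_cast h
  rw [div_pow, one_pow, one_div, inv_mul_eq_div, le_div_iff₀ (by positivity)]
  linarith

theorem tendsto_card_wordBall (hκ : 1 < Nat.card κ) :
    Tendsto (fun p => ((wordBall b p).card : ℝ)) atTop atTop := by
  refine tendsto_atTop_mono (fun p => ?_)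
    (tendsto_pow_atTop_atTop_of_one_lt (by norm_num : (1 : ℝ) < 2))
  have h := two_pow_mul_card_wordBall_le b hκ 0 p
  rw [zero_add] at h
  have h0 := card_wordBall_pos b 0
  exact_mod_cast (Nat.le_mul_of_pos_right (2 ^ p) h0).trans h

/-- The packing bound gives the ratio at most `1 / |ball| + 1 / (C + 1)`; once the ball has `C + 1`
elements the first term is no larger than the second. -/
theorem upperDensity_subgroup_le (hκ : 1 < Nat.card κ) (S : Subgroup H) (C : ℕ)
    (hS : ∀ h ∈ S, h ≠ 1 → 2 * C < wordLength b h) :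
    upperDensity b (S : Set H) ≤ 2 / (C + 1) := by
  refine upperDensity_le b ?_
  filter_upwards [(tendsto_card_wordBall b hκ).eventually_ge_atTop (C + 1)] with p hp
  have h := card_subgroup_inter_wordBall_le b S C p hS
  have h' : ((C : ℝ) + 1) * (((S : Set H) ∩ (wordBall b p : Set H)).ncard : ℝ) ≤
      (C + 1) + (wordBall b p).card := by exact_mod_cast h
  have h0 : (0 : ℝ) < (wordBall b p).card := by exact_mod_cast card_wordBall_pos b p
  rw [ballRatio, div_le_div_iff₀ h0 (by positivity)]
  linarith

end

/-! ### Generic tuples -/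

/-- Fubini for counting: freeze all coordinates but `j` and bound each fibre. -/
theorem card_filter_piFinset_le {ι α : Type*} [Fintype ι] [DecidableEq ι] [DecidableEq α]
    (B : Finset α) (j : ι) (Q : (ι → α) → Prop) [DecidablePred Q] {ε : ℝ}
    (hQ : ∀ t : ι → α, ((B.filter fun h => Q (Function.update t j h)).card : ℝ) ≤ ε * B.card) :
    (((Fintype.piFinset fun _ : ι => B).filter Q).card : ℝ) ≤
      ε * (B.card : ℝ) ^ Fintype.card ι := by
  let r : (ι → α) → ({i // i ≠ j} → α) := fun t i => t i
  have hmaps : ∀ t ∈ (Fintype.piFinset fun _ : ι => B).filter Q,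
      r t ∈ Fintype.piFinset fun _ : {i // i ≠ j} => B := fun t ht =>
    Fintype.mem_piFinset.2 fun i => Fintype.mem_piFinset.1 (Finset.mem_filter.1 ht).1 i
  have hcard : Fintype.card ι = Fintype.card {i // i ≠ j} + 1 := by
    have : 0 < Fintype.card ι := Fintype.card_pos_iff.2 ⟨j⟩
    rw [Fintype.card_subtype_compl, Fintype.card_subtype_eq]
    omega
  rw [Finset.card_eq_sum_card_fiberwise hmaps, hcard, pow_succ, Nat.cast_sum]
  have hfib : ∀ s ∈ Fintype.piFinset fun _ : {i // i ≠ j} => B,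
      ((((Fintype.piFinset fun _ : ι => B).filter Q).filter fun t => r t = s).card : ℝ) ≤
        ε * B.card := by
    intro s _
    rcases (((Fintype.piFinset fun _ : ι => B).filter Q).filter
      fun t => r t = s).eq_empty_or_nonempty with h0 | ⟨t₀, ht₀⟩
    · rw [h0, Finset.card_empty, Nat.cast_zero]
      -- The sign of `ε` is not assumed; `0 ≤ ε * B.card` comes from `hQ` at a constant tuple.
      rcases B.eq_empty_or_nonempty with rfl | ⟨a, -⟩
      · simp
      · exact le_trans (Nat.cast_nonneg _) (hQ fun _ => a)
    · have h0 := (Finset.mem_filter.1 ht₀).2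
      have hup : ∀ t, r t = s → Function.update t₀ j (t j) = t := by
        intro t ht
        funext i
        by_cases hi : i = j
        · subst hi; simp
        · rw [Function.update_of_ne hi]
          exact congrFun (h0.trans ht.symm) ⟨i, hi⟩
      refine le_trans ?_ (hQ t₀)
      norm_cast
      refine Finset.card_le_card_of_injOn (fun t => t j) ?_ ?_
      · intro t ht
        obtain ⟨ht1, ht2⟩ := Finset.mem_filter.1 ht
        obtain ⟨ht3, ht4⟩ := Finset.mem_filter.1 ht1
        refine Finset.mem_filter.2 ⟨Fintype.mem_piFinset.1 ht3 j, ?_⟩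
        rwa [hup t ht2]
      · intro t ht t' ht' h
        rw [← hup t (Finset.mem_filter.1 ht).2, ← hup t' (Finset.mem_filter.1 ht').2]
        simp only at h
        rw [h]
  refine (Finset.sum_le_sum hfib).trans ?_
  rw [Finset.sum_const, Fintype.card_piFinset, Finset.prod_const, Finset.card_univ, nsmul_eq_mul]
  push_cast
  linarith

section
variable {κ H : Type*} [Group H] [DecidableEq κ] (b : FreeGroupBasis κ H) [Finite κ]

/-- Deleting the prescribed prefix `q` loses no information and shortens the word by `L`. -/
theorem card_filter_take_word_eq_le (q : List (κ × Bool)) (ε : Bool) (p L : ℕ) :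
    ((wordBall b p).filter fun h => L ≤ wordLength b h ∧
      (word b (bif ε then h else h⁻¹)).take L = q).card ≤ (wordBall b (p - L)).card := by
  have hlen : ∀ h : H, wordLength b (bif ε then h else h⁻¹) = wordLength b h := by
    intro h; cases ε <;> simp [wordLength_inv]
  have hred : ∀ h : H, FreeGroup.IsReduced ((word b (bif ε then h else h⁻¹)).drop L) := fun h =>
    (isReduced_word b _).infix (List.drop_suffix _ _).isInfix
  refine Finset.card_le_card_of_injOn
    (fun h => ofWord b ((word b (bif ε then h else h⁻¹)).drop L)) ?_ ?_
  · intro h hh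
    obtain ⟨h1, h2, -⟩ := Finset.mem_filter.1 hh
    rw [mem_wordBall] at h1
    refine mem_wordBall.2 ?_
    rw [← length_word, word_ofWord b (hred h), List.length_drop, length_word, hlen]
    omega
  · intro h hh h' hh' heq
    have h1 := congrArg (word b) heq
    simp only [word_ofWord b (hred _)] at h1
    have h2 := (Finset.mem_filter.1 hh).2.2.trans (Finset.mem_filter.1 hh').2.2.symm
    have h3 : word b (bif ε then h else h⁻¹) = word b (bif ε then h' else h'⁻¹) := by
      rw [← List.take_append_drop L (word b (bif ε then h else h⁻¹)), h1, h2,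
        List.take_append_drop]
    have h4 := word_injective b h3
    cases ε <;> simpa using h4

/-- Such a word ends with the inverse of its own first `L` letters. As `2 * L` is at most its
length, that prefix survives deletion of the last `L` letters, which can then be restored. -/
theorem card_filter_take_word_inv_le (p L : ℕ) :
    ((wordBall b p).filter fun h => 2 * L ≤ wordLength b h ∧
      (word b h).take L = (word b h⁻¹).take L).card ≤ (wordBall b (p - L)).card := by
  have hred : ∀ h : H, FreeGroup.IsReduced ((word b h).take (wordLength b h - L)) := fun h =>
    (isReduced_word b _).infix (List.take_prefix _ _).isInfix
  have hword : ∀ h : H, 2 * L ≤ wordLength b h → (word b h).take L = (word b h⁻¹).take L →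
      word b h = (word b h).take (wordLength b h - L) ++
        FreeGroup.invRev (((word b h).take (wordLength b h - L)).take L) := by
    intro h h1 h2
    rw [List.take_take, min_eq_left (by omega), h2]
    conv_lhs => rw [← List.take_append_drop (wordLength b h - L) (word b h)]
    congr 1
    rw [word_inv]
    simp only [FreeGroup.invRev, ← List.map_take, ← List.map_reverse, List.take_reverse,
      length_word]
    simp [Function.comp_def, List.map_drop]
  refine Finset.card_le_card_of_injOn
    (fun h => ofWord b ((word b h).take (wordLength b h - L))) ?_ ?_
  · intro h hh
    obtain ⟨h1, h2, -⟩ := Finset.mem_filter.1 hh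
    rw [mem_wordBall] at h1
    refine mem_wordBall.2 ?_
    rw [← length_word, word_ofWord b (hred h), List.length_take, length_word]
    omega
  · intro h hh h' hh' heq
    have h1 := congrArg (word b) heq
    simp only [word_ofWord b (hred _)] at h1
    obtain ⟨-, h2, h3⟩ := Finset.mem_filter.1 hh
    obtain ⟨-, h2', h3'⟩ := Finset.mem_filter.1 hh'
    apply word_injective b
    rw [hword h h2 h3, hword h' h2' h3', h1]

theorem upperDensity_closure_le {ι : Type*} [DecidableEq ι] (hκ : 1 < Nat.card κ) {L C : ℕ} {t : ι → H}
    (hlen : ∀ i, 2 * L + 2 * C < wordLength b (t i))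
    (hinj : ∀ x y : ι × Bool, x ≠ y → (word b (bif x.2 then t x.1 else (t x.1)⁻¹)).take L ≠
      (word b (bif y.2 then t y.1 else (t y.1)⁻¹)).take L) :
    upperDensity b (Subgroup.closure (Set.range t) : Set H) ≤ 2 / (C + 1) := by
  refine upperDensity_subgroup_le b hκ _ C fun h hh h1 => ?_
  refine lt_norm_of_mem_closure (f := fun i => b.repr (t i)) (L := L) hlen ?_ ?_ ?_
  · intro x y hxy
    by_contra hne
    refine hinj x y hne ?_
    have e : ∀ x : ι × Bool, (bif x.2 then b.repr (t x.1) else (b.repr (t x.1))⁻¹) =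
        b.repr (bif x.2 then t x.1 else (t x.1)⁻¹) := by
      rintro ⟨i, _ | _⟩ <;> simp
    rw [e, e] at hxy
    exact hxy
  · have := Subgroup.mem_map_of_mem b.repr.toMonoidHom hh
    rw [MonoidHom.map_closure, ← Set.range_comp] at this
    exact this
  · simpa using h1

variable {ι : Type*} [Fintype ι] [DecidableEq ι]

/-- Tuples for which two distinct signed entries share a long prefix are rare. -/
theorem card_filter_take_eq_le (hκ : 1 < Nat.card κ) {p L : ℕ} (hL : L ≤ p) {x y : ι × Bool}
    (hxy : x ≠ y) [DecidableEq H] :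
    (((Fintype.piFinset fun _ : ι => wordBall b p).filter fun t =>
      (∀ i, 2 * L ≤ wordLength b (t i)) ∧
      (word b (bif x.2 then t x.1 else (t x.1)⁻¹)).take L =
        (word b (bif y.2 then t y.1 else (t y.1)⁻¹)).take L).card : ℝ) ≤
      (1 / 2) ^ L * ((wordBall b p).card : ℝ) ^ Fintype.card ι := by
  obtain ⟨i, ε⟩ := x
  obtain ⟨j, δ⟩ := y
  refine card_filter_piFinset_le (wordBall b p) j _ fun t =>
    le_trans ?_ (card_wordBall_sub_le b hκ hL)
  norm_cast
  -- Only coordinate `j` varies. If `i = j` the signs differ and `h` is compared with `h⁻¹`;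
  -- otherwise the frozen entry `t i` prescribes the prefix.
  by_cases hij : i = j
  · subst hij
    have hεδ : ε ≠ δ := fun h => hxy (by rw [h])
    refine le_trans (Finset.card_le_card ?_) (card_filter_take_word_inv_le b p L)
    refine Finset.monotone_filter_right _ fun h _ hh => ?_
    obtain ⟨h1, h2⟩ := hh
    have h1' := h1 i
    simp only [Function.update_self] at h1' h2
    refine ⟨h1', ?_⟩
    cases ε <;> cases δ <;> simp_all
  · refine le_trans (Finset.card_le_card ?_) (card_filter_take_word_eq_le b
      ((word b (bif ε then t i else (t i)⁻¹)).take L) δ p L)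
    refine Finset.monotone_filter_right _ fun h _ hh => ?_
    obtain ⟨h1, h2⟩ := hh
    have h1' := h1 j
    simp only [Function.update_self, Function.update_of_ne hij] at h1' h2
    exact ⟨by omega, h2.symm⟩

/-- Tuples with a short entry are rare. -/
theorem card_filter_short_le [DecidableEq H] (p M : ℕ) (j : ι) :
    (((Fintype.piFinset fun _ : ι => wordBall b p).filter fun t =>
      wordLength b (t j) ≤ M).card : ℝ) ≤
      ((wordBall b M).card / (wordBall b p).card : ℝ) *
        ((wordBall b p).card : ℝ) ^ Fintype.card ι := by
  refine card_filter_piFinset_le (wordBall b p) j _ fun t => ?_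
  have h0 : ((wordBall b p).card : ℝ) ≠ 0 := by exact_mod_cast (card_wordBall_pos b p).ne'
  rw [div_mul_cancel₀ _ h0]
  norm_cast
  refine Finset.card_le_card fun h hh => ?_
  have := (Finset.mem_filter.1 hh).2
  rw [Function.update_self] at this
  exact mem_wordBall.2 this

/-- A union bound: the three terms account for tuples with a short entry, tuples with coinciding
prefixes, and the remaining tuples, to which ping-pong applies. -/
theorem averageDensity_le (hκ : 1 < Nat.card κ) {G : Type*} [Group G] (bG : FreeGroupBasis ι G)
    {p L C : ℕ} (hL : L ≤ p) :
    averageDensity bG b p ≤ Fintype.card ι *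
        ((wordBall b (2 * L + 2 * C)).card / (wordBall b p).card : ℝ) +
      (Fintype.card (ι × Bool) * Fintype.card (ι × Bool)) * (1 / 2) ^ L + 2 / (C + 1) := by
  classical
  set P := Fintype.piFinset fun _ : ι => wordBall b p with hP
  have hPc : (P.card : ℝ) = ((wordBall b p).card : ℝ) ^ Fintype.card ι := by
    rw [hP, Fintype.card_piFinset, Finset.prod_const, Finset.card_univ]
    push_cast
    rfl
  have h0 : (0 : ℝ) < ((wordBall b p).card : ℝ) ^ Fintype.card ι := by
    have := card_wordBall_pos b p
    positivity
  let T : (ι → H) → ι × Bool → List (κ × Bool) := fun t x =>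
    (word b (bif x.2 then t x.1 else (t x.1)⁻¹)).take L
  let short : ι → Finset (ι → H) := fun j =>
    P.filter fun t => wordLength b (t j) ≤ 2 * L + 2 * C
  let meet : (ι × Bool) × (ι × Bool) → Finset (ι → H) := fun z =>
    if z.1 = z.2 then ∅ else P.filter fun t => (∀ i, 2 * L ≤ wordLength b (t i)) ∧
      T t z.1 = T t z.2
  -- On an exceptional tuple some indicator equals `1`, which already dominates any density.
  have hpt : ∀ t ∈ P, upperDensity b ((bG.lift t).range : Set H) ≤
      ((∑ j, if t ∈ short j then (1 : ℝ) else 0) + ∑ z, if t ∈ meet z then (1 : ℝ) else 0) +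
        2 / (C + 1) := by
    intro t ht
    have hn1 : ∀ j ∈ Finset.univ, (0 : ℝ) ≤ if t ∈ short j then (1 : ℝ) else 0 := fun j _ => by
      split_ifs <;> norm_num
    have hn2 : ∀ z ∈ Finset.univ, (0 : ℝ) ≤ if t ∈ meet z then (1 : ℝ) else 0 := fun j _ => by
      split_ifs <;> norm_num
    have hs1 := Finset.sum_nonneg hn1
    have hs2 := Finset.sum_nonneg hn2
    have hC : (0 : ℝ) < 2 / (C + 1) := by positivity
    have hle1 := upperDensity_le_one b ((bG.lift t).range : Set H)
    by_cases h1 : ∃ j, t ∈ short j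
    · obtain ⟨j, hj⟩ := h1
      have := Finset.single_le_sum hn1 (Finset.mem_univ j)
      rw [if_pos hj] at this
      linarith
    by_cases h2 : ∃ z, t ∈ meet z
    · obtain ⟨z, hz⟩ := h2
      have := Finset.single_le_sum hn2 (Finset.mem_univ z)
      rw [if_pos hz] at this
      linarith
    have hlen : ∀ i, 2 * L + 2 * C < wordLength b (t i) := fun i => by
      by_contra h
      exact h1 ⟨i, Finset.mem_filter.2 ⟨ht, by omega⟩⟩
    have := upperDensity_closure_le b hκ hlen fun x y hxy hT => h2 ⟨(x, y), by
      simp only [meet, if_neg hxy]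
      exact Finset.mem_filter.2 ⟨ht, fun i => by have := hlen i; omega, hT⟩⟩
    rw [range_lift_eq_closure]
    linarith
  rw [averageDensity, one_div_mul_eq_div, div_le_iff₀ h0]
  refine (Finset.sum_le_sum hpt).trans ?_
  rw [Finset.sum_add_distrib, Finset.sum_add_distrib, Finset.sum_comm, Finset.sum_comm (s := P),
    Finset.sum_const, nsmul_eq_mul, hPc]
  have hA : ∑ j, ∑ t ∈ P, (if t ∈ short j then (1 : ℝ) else 0) ≤ Fintype.card ι *
      (((wordBall b (2 * L + 2 * C)).card / (wordBall b p).card : ℝ) *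
        ((wordBall b p).card : ℝ) ^ Fintype.card ι) := by
    rw [← nsmul_eq_mul, ← Finset.card_univ]
    refine Finset.sum_le_card_nsmul _ _ _ fun j _ => ?_
    rw [Finset.sum_boole]
    refine le_trans ?_ (card_filter_short_le b p (2 * L + 2 * C) j)
    exact_mod_cast Finset.card_le_card fun t ht => (Finset.mem_filter.1 ht).2
  have hB : ∑ z, ∑ t ∈ P, (if t ∈ meet z then (1 : ℝ) else 0) ≤
      ((Fintype.card (ι × Bool) * Fintype.card (ι × Bool) : ℕ) : ℝ) *
      ((1 / 2) ^ L * ((wordBall b p).card : ℝ) ^ Fintype.card ι) := by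
    rw [← nsmul_eq_mul, ← Fintype.card_prod, ← Finset.card_univ]
    refine Finset.sum_le_card_nsmul _ _ _ fun z _ => ?_
    rw [Finset.sum_boole]
    by_cases hz : z.1 = z.2
    · simp only [meet, if_pos hz, Finset.notMem_empty, Finset.filter_false, Finset.card_empty,
        Nat.cast_zero]
      positivity
    · refine le_trans ?_ (card_filter_take_eq_le b hκ hL hz)
      norm_cast
      refine Finset.card_le_card fun t ht => ?_
      have := (Finset.mem_filter.1 ht).2
      simpa only [meet, if_neg hz] using this
  push_cast at hB
  linarith

theorem averageDensity_nonneg {G : Type*} [Group G] (bG : FreeGroupBasis ι G) (p : ℕ) :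
    0 ≤ averageDensity bG b p :=
  mul_nonneg (by positivity) (Finset.sum_nonneg fun _ _ => upperDensity_nonneg b _)

theorem hasExpectedDensity_zero (hκ : 1 < Nat.card κ) {G : Type*} [Group G]
    (bG : FreeGroupBasis ι G) : HasExpectedDensity bG b 0 := by
  rw [HasExpectedDensity, Metric.tendsto_nhds]
  intro ε hε
  -- The order matters: `C` and `L` are fixed before `p` grows, so the ball of radius `2 * L + 2 *
  -- C` becomes negligible.
  obtain ⟨C, hC⟩ : ∃ C : ℕ, (2 : ℝ) / (C + 1) < ε / 3 :=
    (((tendsto_atTop_add_const_right _ (1 : ℝ)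
      tendsto_natCast_atTop_atTop).const_div_atTop 2).eventually_lt_const
        (by positivity : (0 : ℝ) < ε / 3)).exists
  obtain ⟨L, hL⟩ : ∃ L : ℕ, (Fintype.card (ι × Bool) * Fintype.card (ι × Bool) : ℝ) *
      (1 / 2) ^ L < ε / 3 := by
    have h := (tendsto_pow_atTop_nhds_zero_of_lt_one (by norm_num : (0 : ℝ) ≤ 1 / 2)
      (by norm_num)).const_mul (Fintype.card (ι × Bool) * Fintype.card (ι × Bool) : ℝ)
    rw [mul_zero] at h
    exact (h.eventually_lt_const (by positivity : (0 : ℝ) < ε / 3)).exists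
  have h := ((tendsto_card_wordBall b hκ).const_div_atTop
    ((wordBall b (2 * L + 2 * C)).card : ℝ)).const_mul (Fintype.card ι : ℝ)
  rw [mul_zero] at h
  filter_upwards [h.eventually_lt_const (by positivity : (0 : ℝ) < ε / 3),
    eventually_ge_atTop L] with p hp hpL
  rw [Real.dist_eq, sub_zero, abs_of_nonneg (averageDensity_nonneg b bG p)]
  have := averageDensity_le b hκ bG (C := C) hpL
  linarith

end

end FreeDensity

end

theorem mainTheorem5 {ι κ G H : Type*} [Group G] [Group H]
    [Fintype ι] [DecidableEq ι] [Fintype κ] [DecidableEq κ]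
    (bG : FreeGroupBasis ι G) (bH : FreeGroupBasis κ H) :
    (Fintype.card κ = 1 →
      ∀ φ : G →* H, ∃ d : ℝ, FreeDensity.HasDensity bH (φ.range : Set H) d) ∧
    (Fintype.card κ = 1 → 1 < Fintype.card ι →
      ∃ e : ℝ, FreeDensity.HasExpectedDensity bG bH e ∧
        (e : ℂ) = riemannZeta ((Fintype.card ι : ℂ) + 1) / riemannZeta (Fintype.card ι : ℂ)) ∧
    (((Fintype.card ι = 1 ∧ Fintype.card κ = 1) ∨ 1 < Fintype.card κ) →
      FreeDensity.HasExpectedDensity bG bH 0) := by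
  refine ⟨fun h φ => ?_, fun h hn => ?_, ?_⟩
  · obtain ⟨_⟩ := Fintype.card_eq_one_iff_nonempty_unique.1 h
    exact FreeDensity.exists_hasDensity_range bH φ
  · obtain ⟨_⟩ := Fintype.card_eq_one_iff_nonempty_unique.1 h
    refine ⟨_, (FreeDensity.tendsto_average_inv_gcd (by omega)
      (FreeDensity.tendsto_primitiveCount hn)).congr fun p =>
        (FreeDensity.averageDensity_of_unique bH bG p).symm, ?_⟩
    rw [Complex.ofReal_mul, FreeDensity.tsum_moebius_div_pow hn,
      FreeDensity.tsum_one_div_pow (by omega), div_eq_inv_mul]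
    push_cast
    rfl
  · rintro (⟨hn, h⟩ | h)
    · obtain ⟨_⟩ := Fintype.card_eq_one_iff_nonempty_unique.1 h
      have := FreeDensity.tendsto_average_inv_gcd (by omega)
        (FreeDensity.tendsto_primitiveCount_of_card_eq_one hn)
      rw [zero_mul] at this
      exact this.congr fun p => (FreeDensity.averageDensity_of_unique bH bG p).symm
    · exact FreeDensity.hasExpectedDensity_zero bH (by rwa [Nat.card_eq_fintype_card]) bG
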